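/- Let $0\le p\le 1$ and $q=1-p$. For $n\ge 1$ let $G(n,p)$ be the random graph on $n$ labelled vertices in which each of the $\binom n2$ possible edges is present with probability $p$, independently of the others, and let $\nu_n$ be the number of connected components of $G(n,p)$. For a real number $z$ and an integer $s\ge 0$ write $z^{\underline s}=z(z-1)\cdots(z-s+1)$. Then for all integers $n\ge 1$ and $s\ge 1$ and all $p\in[0,1]$, $$ (n-1)^{\underline s}\,q^{(n-1)s}\ \le\ \mathsf{E}\,(\nu_n-1)^{\underline s}\ \le\ 2\,(n-1)^{\underline s}\,q^{(n-1)(s+1)/2}, $$ where $0^0=1$. -/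

import Mathlib

open MeasureTheory

noncomputable section

/-- The number of connected components of a graph `g` on the vertices `0, …, n - 1`. -/
def componentCount {n : ℕ} (g : SimpleGraph (Fin n)) : ℕ :=
  Nat.card g.ConnectedComponent

/-- The `s`-th factorial power `z (z - 1) ⋯ (z - s + 1)` of a real number `z`. -/
def factorialPower (z : ℝ) (s : ℕ) : ℝ :=
  (descPochhammer ℝ s).eval z

/-- The `s`-th factorial moment of `ν - 1`, where `ν` is the number of connected components of the
random graph `G(n, p)`: there are `n` labelled vertices, and each of the `n (n - 1) / 2` possible
edges is present with probability `p`, independently of the other ones. -/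
def excessFactorialMoment (n : ℕ) (p : unitInterval) (s : ℕ) : ℝ :=
  ∫ g, factorialPower ((componentCount g : ℝ) - 1) s ∂(SimpleGraph.binomialRandom (Fin n) p)

end

/-! ### Random subsets and Russo's formula. -/

section BernoulliSum

/-! Let N = n - 1, let m be the excess ν - 1, and let f_s be its s-th factorial moment as a function
of q. With q = exp(-t), edges arrive at independent exponential times and m decreases in t. By
Russo's formula (`hasDerivAt_sum_subsetWeight`), q d/dq of an expectation is the expected total loss
over the missing edges. Among graphs with m + 1 components, the fewest pairs are separated when m
vertices are isolated, so m drops at rate at least m(2N + 1 - m)/2 (`le_two_mul_card_crossGraph`,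
`le_sum_sub_insert`).

Upper bound for s ≥ 2 or s ≥ N: these rates send factorial powers to factorial powers, so q f_s' ≥
(s/2)((2N + 1 - s) f_s - f_{s+1}). Descending induction on s compares f_s with an explicit
supersolution (`factorialMomentSum_sq_le`). That comparison can fail for s = 1, where a
supersolution of the death chain's backward equation is used instead (`factorialMomentSum_one_le`).

Lower bound: m is at least the number of isolated vertices other than a fixed one, and the factorial
moment of that number is (N)_s times the probability that s given vertices are isolated
(`le_factorialMomentSum`). -/

variable {α : Type*}

/-- The probability that a random subset of `E`, from which each element is missing with
probability `q` independently of the others, equals `S`. -/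
def subsetWeight (E S : Finset α) (q : ℝ) : ℝ :=
  (1 - q) ^ S.card * q ^ (E.card - S.card)

lemma subsetWeight_nonneg (E S : Finset α) {q : ℝ} (h0 : 0 ≤ q) (h1 : q ≤ 1) :
    0 ≤ subsetWeight E S q :=
  mul_nonneg (pow_nonneg (by linarith) _) (pow_nonneg h0 _)

lemma continuous_subsetWeight (E S : Finset α) : Continuous (subsetWeight E S) := by
  unfold subsetWeight; fun_prop

lemma sum_subsetWeight_one (E : Finset α) (ψ : Finset α → ℝ) :
    ∑ S ∈ E.powerset, subsetWeight E S 1 * ψ S = ψ ∅ := by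
  rw [Finset.sum_eq_single ∅]
  · simp [subsetWeight]
  · intro S _ hS
    have : S.card ≠ 0 := by simpa using hS
    simp [subsetWeight, this]
  · simp

lemma hasDerivAt_subsetWeight (E S : Finset α) (q : ℝ) :
    HasDerivAt (subsetWeight E S)
      (-(S.card * (1 - q) ^ (S.card - 1)) * q ^ (E.card - S.card) +
        (1 - q) ^ S.card * ((E.card - S.card : ℕ) * q ^ (E.card - S.card - 1))) q := by
  have h1 := ((hasDerivAt_const q (1 : ℝ)).sub (hasDerivAt_id q)).pow S.card
  have h2 := (hasDerivAt_id q).pow (E.card - S.card)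
  refine (h1.mul h2).congr_deriv ?_
  simp

variable [DecidableEq α]

/-- The probability that a random subset of `E` avoids `F ⊆ E`. -/
lemma sum_subsetWeight_sdiff (E F : Finset α) (hF : F ⊆ E) (q : ℝ) :
    ∑ S ∈ (E \ F).powerset, subsetWeight E S q = q ^ F.card := by
  have h := Finset.sum_pow_mul_eq_add_pow (1 - q) q (E \ F)
  rw [sub_add_cancel, one_pow] at h
  rw [← mul_one (q ^ F.card), ← h, Finset.mul_sum]
  refine Finset.sum_congr rfl fun S hS => ?_
  have h1 := Finset.card_le_card (Finset.mem_powerset.1 hS)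
  have h2 := Finset.card_sdiff_add_card_eq_card hF
  rw [subsetWeight, show E.card - S.card = F.card + ((E \ F).card - S.card) by omega, pow_add]
  ring

/-- Adding a missing element is a bijection onto the pairs of a set and one of its elements. -/
lemma sum_sdiff_insert (E : Finset α) (f : Finset α → α → ℝ) :
    ∑ S ∈ E.powerset, ∑ e ∈ E \ S, f (insert e S) e = ∑ S ∈ E.powerset, ∑ e ∈ S, f S e := by
  rw [Finset.sum_sigma', Finset.sum_sigma']
  refine Finset.sum_bij' (fun x _ => ⟨insert x.2 x.1, x.2⟩) (fun x _ => ⟨x.1.erase x.2, x.2⟩)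
    ?_ ?_ ?_ ?_ ?_
  · rintro ⟨S, e⟩ h
    simp only [Finset.mem_sigma, Finset.mem_powerset, Finset.mem_sdiff] at h ⊢
    exact ⟨Finset.insert_subset h.2.1 h.1, Finset.mem_insert_self _ _⟩
  · rintro ⟨S, e⟩ h
    simp only [Finset.mem_sigma, Finset.mem_powerset, Finset.mem_sdiff] at h ⊢
    exact ⟨(Finset.erase_subset _ _).trans h.1, h.1 h.2, Finset.notMem_erase _ _⟩
  · rintro ⟨S, e⟩ h
    simp only [Finset.mem_sigma, Finset.mem_powerset, Finset.mem_sdiff] at h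
    simp [Finset.erase_insert h.2.2]
  · rintro ⟨S, e⟩ h
    simp only [Finset.mem_sigma, Finset.mem_powerset] at h
    simp [Finset.insert_erase h.2]
  · simp

/-- Differentiating (1 - q)^|S| gives one term for each e ∈ S, and q times that term carries the
weight of S without e. Reindexing by (S without e, e) turns these terms into the losses over missing
elements. -/
lemma sum_deriv_subsetWeight (E : Finset α) (ψ : Finset α → ℝ) (q : ℝ) :
    q * ∑ S ∈ E.powerset, (-(S.card * (1 - q) ^ (S.card - 1)) * q ^ (E.card - S.card) +
        (1 - q) ^ S.card * ((E.card - S.card : ℕ) * q ^ (E.card - S.card - 1))) * ψ S =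
      ∑ S ∈ E.powerset, subsetWeight E S q * ∑ e ∈ E \ S, (ψ S - ψ (insert e S)) := by
  have h := sum_sdiff_insert E
    (fun T _ => (1 - q) ^ (T.card - 1) * q ^ (E.card - T.card + 1) * ψ T)
  simp only [Finset.sum_const, nsmul_eq_mul] at h
  have h' : ∑ S ∈ E.powerset, ∑ e ∈ E \ S, subsetWeight E S q * ψ (insert e S) =
      ∑ S ∈ E.powerset, (S.card : ℝ) *
        ((1 - q) ^ (S.card - 1) * q ^ (E.card - S.card + 1) * ψ S) := by
    rw [← h]
    refine Finset.sum_congr rfl fun S hS => Finset.sum_congr rfl fun e he => ?_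
    rw [Finset.mem_sdiff] at he
    have hc := Finset.card_le_card
      (Finset.insert_subset he.1 (Finset.mem_powerset.1 hS))
    rw [Finset.card_insert_of_notMem he.2] at hc ⊢
    rw [subsetWeight, show E.card - (S.card + 1) + 1 = E.card - S.card by omega,
      Nat.add_sub_cancel]
  simp only [mul_sub, Finset.sum_sub_distrib, Finset.mul_sum, h']
  rw [← Finset.sum_sub_distrib]
  refine Finset.sum_congr rfl fun S hS => ?_
  rw [Finset.sum_const, nsmul_eq_mul, Finset.card_sdiff_of_subset (Finset.mem_powerset.1 hS),
    subsetWeight]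
  rcases Nat.eq_zero_or_pos (E.card - S.card) with h0 | h0
  · simp [h0]; ring
  · obtain ⟨k, hk⟩ := Nat.exists_eq_succ_of_ne_zero h0.ne'
    simp only [hk, Nat.succ_eq_add_one, Nat.add_sub_cancel]
    ring

/-- Russo's formula, with an additional dependence of the integrand on the parameter. -/
lemma hasDerivAt_sum_subsetWeight (E : Finset α) (ψ : Finset α → ℝ → ℝ) (ψ' : Finset α → ℝ)
    {q : ℝ} (hq : q ≠ 0) (hψ : ∀ S ∈ E.powerset, HasDerivAt (ψ S) (ψ' S) q) :
    HasDerivAt (fun x => ∑ S ∈ E.powerset, subsetWeight E S x * ψ S x)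
      (q⁻¹ * ∑ S ∈ E.powerset, subsetWeight E S q *
        (∑ e ∈ E \ S, (ψ S q - ψ (insert e S) q) + q * ψ' S)) q := by
  have h := HasDerivAt.fun_sum fun S hS => (hasDerivAt_subsetWeight E S q).mul (hψ S hS)
  refine h.congr_deriv ?_
  rw [Finset.sum_add_distrib]
  simp only [mul_add, Finset.sum_add_distrib]
  rw [← sum_deriv_subsetWeight E (fun S => ψ S q) q, ← mul_assoc, inv_mul_cancel₀ hq, one_mul,
    Finset.mul_sum]
  congr 1
  refine Finset.sum_congr rfl fun S _ => ?_
  field_simp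

end BernoulliSum

/-! ### Components, and pairs of vertices that they separate. -/

section Graph

/-- The edges of the complete graph on `0, …, n - 1`. -/
def allEdges (n : ℕ) : Finset (Sym2 (Fin n)) := Finset.univ.filter fun e => ¬ e.IsDiag

/-- One less than the number of connected components of the graph with edge set `S`. -/
noncomputable def excess {n : ℕ} (S : Finset (Sym2 (Fin n))) : ℕ :=
  componentCount (SimpleGraph.fromEdgeSet (S : Set (Sym2 (Fin n)))) - 1

variable {n : ℕ}

lemma componentCount_pos (hn : 1 ≤ n) (g : SimpleGraph (Fin n)) : 0 < componentCount g := by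
  have : Nonempty (Fin n) := ⟨⟨0, hn⟩⟩
  exact Nat.card_pos

lemma componentCount_le (g : SimpleGraph (Fin n)) : componentCount g ≤ n := by
  have := Nat.card_le_card_of_surjective g.connectedComponentMk Quot.mk_surjective
  simpa [componentCount] using this

lemma excess_le (S : Finset (Sym2 (Fin n))) : excess S ≤ n - 1 :=
  Nat.sub_le_sub_right (componentCount_le _) 1

lemma excess_empty : excess (∅ : Finset (Sym2 (Fin n))) = n - 1 := by
  have : componentCount (⊥ : SimpleGraph (Fin n)) = n := by
    refine le_antisymm (componentCount_le _) ?_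
    have := Nat.card_le_card_of_injective (⊥ : SimpleGraph (Fin n)).connectedComponentMk
      (fun u v h => by simpa using SimpleGraph.ConnectedComponent.exact h)
    simpa [componentCount] using this
  simp [excess, this]

lemma factorialPower_natCast (m s : ℕ) : factorialPower m s = m.descFactorial s :=
  descPochhammer_eval_eq_descFactorial ℝ m s

lemma measurableSingletonClass_simpleGraph :
    MeasurableSingletonClass (SimpleGraph (Fin n)) := by
  refine ⟨fun g => ⟨{g.Adj}, measurableSet_singleton _, ?_⟩⟩
  ext h
  exact ⟨fun hh => SimpleGraph.ext hh, fun hh => congrArg SimpleGraph.Adj hh⟩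

lemma edgeSet_fromEdgeSet_of_subset {S : Finset (Sym2 (Fin n))} (hS : S ⊆ allEdges n) :
    (SimpleGraph.fromEdgeSet (S : Set (Sym2 (Fin n)))).edgeSet = S := by
  rw [SimpleGraph.edgeSet_fromEdgeSet]
  ext e
  have h : e ∈ S → e ∈ allEdges n := fun h => hS h
  simp only [allEdges, Finset.mem_filter, Finset.mem_univ, true_and] at h
  simpa using h

lemma card_allEdges : (allEdges n).card = n.choose 2 := by
  rw [← Fintype.card_fin n, ← Sym2.card_subtype_not_diag, Fintype.card_subtype, Fintype.card_fin]
  rfl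

/-- The factorial moment is a finite sum over edge sets. -/
lemma excessFactorialMoment_eq_sum (hn : 1 ≤ n) (p : unitInterval) (s : ℕ) :
    excessFactorialMoment n p s = ∑ S ∈ (allEdges n).powerset,
      subsetWeight (allEdges n) S (1 - p) * ((excess S).descFactorial s : ℝ) := by
  classical
  have := measurableSingletonClass_simpleGraph (n := n)
  unfold excessFactorialMoment
  rw [integral_fintype Integrable.of_finite]
  symm
  refine Finset.sum_bij' (fun S _ => SimpleGraph.fromEdgeSet (S : Set (Sym2 (Fin n))))
    (fun g _ => g.edgeFinset) ?_ ?_ ?_ ?_ ?_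
  · simp
  · intro g _
    rw [Finset.mem_powerset]
    intro e he
    rw [allEdges, Finset.mem_filter]
    exact ⟨Finset.mem_univ _, g.not_isDiag_of_mem_edgeFinset he⟩
  · intro S hS
    rw [← Finset.coe_inj, SimpleGraph.coe_edgeFinset,
      edgeSet_fromEdgeSet_of_subset (Finset.mem_powerset.1 hS)]
  · simp
  · intro S hS
    have hpos := componentCount_pos hn (SimpleGraph.fromEdgeSet (S : Set (Sym2 (Fin n))))
    rw [smul_eq_mul, measureReal_def, SimpleGraph.binomialRandom_singleton,
      edgeSet_fromEdgeSet_of_subset (Finset.mem_powerset.1 hS), Set.ncard_coe_finset,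
      ← factorialPower_natCast, excess, Nat.cast_sub hpos, Nat.cast_one, subsetWeight,
      card_allEdges]
    simp

/-- The graph joining two vertices when they lie in different components of `g`. -/
def crossGraph (g : SimpleGraph (Fin n)) : SimpleGraph (Fin n) where
  Adj u v := ¬ g.Reachable u v
  symm := ⟨fun _ _ h h' => h h'.symm⟩
  loopless := ⟨fun _ h => h (SimpleGraph.Reachable.refl _)⟩

open Classical in
/-- Many pairs of vertices lie in different components. -/
lemma le_two_mul_card_crossGraph (hn : 1 ≤ n) (g : SimpleGraph (Fin n)) :
    ((componentCount g - 1 : ℕ) : ℝ) * (2 * ((n - 1 : ℕ) : ℝ) + 1 - (componentCount g - 1 : ℕ)) ≤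
      2 * (crossGraph g).edgeFinset.card := by
  obtain ⟨N, rfl⟩ : ∃ N, n = N + 1 := ⟨n - 1, by omega⟩
  set c : g.ConnectedComponent → ℕ := fun C =>
    (Finset.univ.filter fun v => g.connectedComponentMk v = C).card with hc
  have hk : componentCount g = Fintype.card g.ConnectedComponent := Nat.card_eq_fintype_card
  have hsum : ∑ C, c C = N + 1 := by
    have := Finset.card_eq_sum_card_fiberwise (s := Finset.univ) (t := Finset.univ)
      (f := g.connectedComponentMk) (fun _ _ => Finset.mem_coe.2 (Finset.mem_univ _))
    rw [Finset.card_fin] at this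
    exact this.symm
  have hpos : ∀ C, 1 ≤ c C := by
    intro C
    refine C.ind fun v => Finset.card_pos.2 ⟨v, ?_⟩
    simp
  have hle : ∀ C, c C + Fintype.card g.ConnectedComponent ≤ N + 2 := by
    intro C
    have h1 := Finset.add_sum_erase Finset.univ c (Finset.mem_univ C)
    have h2 : (Finset.univ.erase C).card • 1 ≤ ∑ D ∈ Finset.univ.erase C, c D :=
      Finset.card_nsmul_le_sum _ _ 1 (fun D _ => hpos D)
    have h3 : 0 < Fintype.card g.ConnectedComponent := Fintype.card_pos_iff.2 ⟨C⟩
    rw [Finset.card_erase_of_mem (Finset.mem_univ C), Finset.card_univ, smul_eq_mul] at h2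
    omega
  have hdeg : ∀ v, ((crossGraph g).degree v : ℝ) = N + 1 - c (g.connectedComponentMk v) := by
    intro v
    have h1 : (crossGraph g).degree v + c (g.connectedComponentMk v) = N + 1 := by
      rw [← SimpleGraph.card_neighborFinset_eq_degree, SimpleGraph.neighborFinset_eq_filter, hc,
        add_comm]
      have := Finset.card_filter_add_card_filter_not (s := (Finset.univ : Finset (Fin (N + 1))))
        (fun w => g.connectedComponentMk w = g.connectedComponentMk v)
      rw [Finset.card_fin] at this
      refine Eq.trans ?_ this
      congr 2
      ext w
      rw [Finset.mem_filter, Finset.mem_filter]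
      refine and_congr_right fun _ => not_congr ?_
      rw [SimpleGraph.ConnectedComponent.eq]
      exact SimpleGraph.reachable_comm
    rw [eq_sub_iff_add_eq]
    exact_mod_cast h1
  have hsq : ∑ v, (c (g.connectedComponentMk v) : ℝ) = ∑ C, (c C : ℝ) ^ 2 := by
    rw [← Finset.sum_fiberwise Finset.univ g.connectedComponentMk]
    refine Finset.sum_congr rfl fun C _ => ?_
    rw [Finset.sum_congr rfl (g := fun _ => (c C : ℝ))
      (fun v hv => by rw [(Finset.mem_filter.1 hv).2]), Finset.sum_const, nsmul_eq_mul, sq]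
  have h2 : (2 * (crossGraph g).edgeFinset.card : ℝ) =
      (N + 1) * (N + 1) - ∑ C, (c C : ℝ) ^ 2 := by
    rw [← hsq]
    have := (crossGraph g).sum_degrees_eq_twice_card_edges
    have h3 : (2 * (crossGraph g).edgeFinset.card : ℝ) = ∑ v, ((crossGraph g).degree v : ℝ) := by
      exact_mod_cast this.symm
    rw [h3, Finset.sum_congr rfl fun v _ => hdeg v, Finset.sum_sub_distrib]
    simp
    ring
  have hkpos := componentCount_pos hn g
  obtain ⟨m, hm⟩ : ∃ m, componentCount g = m + 1 := ⟨componentCount g - 1, by omega⟩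
  -- Each size lies in [1, N - m + 1], so its square lies below the chord: (c - 1)(c - (N - m + 1))
  -- ≤ 0.
  have h4 : ∑ C, (c C : ℝ) ^ 2 ≤ ∑ C, (((N : ℝ) - m + 2) * c C - (N - m + 1)) := by
    refine Finset.sum_le_sum fun C _ => ?_
    have h5 : (1 : ℝ) ≤ c C := by exact_mod_cast hpos C
    have h6 : (c C : ℝ) + (m + 1) ≤ N + 2 := by
      have := hle C
      rw [← hk, hm] at this
      exact_mod_cast this
    nlinarith
  rw [Finset.sum_sub_distrib, ← Finset.mul_sum, Finset.sum_const, Finset.card_univ, ← hk, hm,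
    nsmul_eq_mul, ← Nat.cast_sum, hsum] at h4
  rw [h2, hm]
  simp only [Nat.add_sub_cancel]
  push_cast at h4
  nlinarith

/-- Joining two components lowers the number of components. -/
lemma componentCount_lt_of_le {g g' : SimpleGraph (Fin n)} (h : g ≤ g') {u v : Fin n}
    (hu : ¬ g.Reachable u v) (hu' : g'.Reachable u v) : componentCount g' < componentCount g := by
  refine lt_of_le_of_ne (SimpleGraph.ConnectedComponent.card_le_card_of_le h) fun he => hu ?_
  have hs := SimpleGraph.ConnectedComponent.surjective_map_ofLE h
  have hb := (Nat.bijective_iff_surjective_and_card _).2 ⟨hs, he.symm⟩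
  refine SimpleGraph.ConnectedComponent.exact (hb.1 ?_)
  simpa using hu'

open Classical in
/-- The expected loss of a monotone function of the number of components when an edge is added. -/
lemma le_sum_sub_insert (hn : 1 ≤ n) {φ : ℕ → ℝ} (hφ : MonotoneOn φ (Set.Iic (n - 1)))
    (S : Finset (Sym2 (Fin n))) :
    (excess S : ℝ) * (2 * ((n - 1 : ℕ) : ℝ) + 1 - excess S) / 2 *
        (φ (excess S) - φ (excess S - 1)) ≤
      ∑ e ∈ allEdges n \ S, (φ (excess S) - φ (excess (insert e S))) := by
  set g := SimpleGraph.fromEdgeSet (S : Set (Sym2 (Fin n))) with hg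
  have hmono : ∀ e, g ≤ SimpleGraph.fromEdgeSet ((insert e S : Finset _) : Set (Sym2 (Fin n))) :=
    fun e => SimpleGraph.fromEdgeSet_mono (by simp)
  have hle : ∀ e, excess (insert e S) ≤ excess S := fun e =>
    Nat.sub_le_sub_right (SimpleGraph.ConnectedComponent.card_le_card_of_le (hmono e)) 1
  have hφ' : ∀ a b, a ≤ b → b ≤ excess S → φ a ≤ φ b := fun a b hab hb =>
    hφ ((hab.trans hb).trans (excess_le S)) (hb.trans (excess_le S)) hab
  have hsub : (crossGraph g).edgeFinset ⊆ allEdges n \ S := by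
    intro e he
    induction e with | _ u v
    rw [SimpleGraph.mem_edgeFinset, SimpleGraph.mem_edgeSet] at he
    have hne := (crossGraph g).ne_of_adj he
    rw [Finset.mem_sdiff, allEdges, Finset.mem_filter]
    refine ⟨⟨Finset.mem_univ _, by simpa using hne⟩, fun hmem => he ?_⟩
    exact SimpleGraph.Adj.reachable ((SimpleGraph.fromEdgeSet_adj _).2 ⟨hmem, hne⟩)
  calc (excess S : ℝ) * (2 * ((n - 1 : ℕ) : ℝ) + 1 - excess S) / 2 *
        (φ (excess S) - φ (excess S - 1))
      ≤ (crossGraph g).edgeFinset.card * (φ (excess S) - φ (excess S - 1)) := by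
        refine mul_le_mul_of_nonneg_right ?_ (sub_nonneg.2 (hφ' _ _ (Nat.sub_le _ _) le_rfl))
        have := le_two_mul_card_crossGraph hn g
        rw [div_le_iff₀ two_pos, mul_comm _ (2 : ℝ)]
        exact this
    _ = ∑ e ∈ (crossGraph g).edgeFinset, (φ (excess S) - φ (excess S - 1)) := by
        rw [Finset.sum_const, nsmul_eq_mul]
    _ ≤ ∑ e ∈ (crossGraph g).edgeFinset, (φ (excess S) - φ (excess (insert e S))) := by
        refine Finset.sum_le_sum fun e he => sub_le_sub_left (hφ' _ _ ?_ (Nat.sub_le _ _)) _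
        induction e with | _ u v
        rw [SimpleGraph.mem_edgeFinset, SimpleGraph.mem_edgeSet] at he
        have hne := (crossGraph g).ne_of_adj he
        have := componentCount_lt_of_le (hmono s(u, v)) he
          (SimpleGraph.Adj.reachable ((SimpleGraph.fromEdgeSet_adj _).2 ⟨by simp, hne⟩))
        unfold excess
        rw [← hg]
        omega
    _ ≤ _ := Finset.sum_le_sum_of_subset_of_nonneg hsub fun e _ _ =>
        sub_nonneg.2 (hφ' _ _ (hle e) le_rfl)

end Graph

/-! ### Upper bound by descending induction on s. -/

section UpperBound

/-- Grönwall's argument, run down from 1: the differential inequality says that h / t^A is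
nondecreasing. -/
lemma nonpos_of_le_mul_deriv {h h' : ℝ → ℝ} (A : ℕ) {x : ℝ} (hx : 0 < x) (hx1 : x ≤ 1)
    (hd : ∀ t ∈ Set.Icc x 1, HasDerivAt h (h' t) t)
    (hi : ∀ t ∈ Set.Icc x 1, A * h t ≤ t * h' t) (h1 : h 1 ≤ 0) : h x ≤ 0 := by
  have hk : ∀ t ∈ Set.Icc x 1, HasDerivAt (fun t => h t / t ^ A)
      ((h' t * t ^ A - h t * (A * t ^ (A - 1))) / (t ^ A) ^ 2) t := fun t ht =>
    (hd t ht).div (hasDerivAt_pow A t) (pow_ne_zero _ (hx.trans_le ht.1).ne')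
  have hmono : MonotoneOn (fun t => h t / t ^ A) (Set.Icc x 1) := by
    refine monotoneOn_of_deriv_nonneg (convex_Icc _ _)
      (fun t ht => (hk t ht).continuousAt.continuousWithinAt) ?_ ?_
    · exact fun t ht => (hk t (interior_subset ht)).differentiableAt.differentiableWithinAt
    · intro t ht
      have ht' := interior_subset ht
      have h0 : 0 < t := hx.trans_le ht'.1
      rw [(hk t ht').deriv]
      refine div_nonneg ?_ (by positivity)
      refine (mul_nonneg_iff_of_pos_left h0).1 ?_
      have hp : t * (A * t ^ (A - 1)) = A * t ^ A := by
        rcases Nat.eq_zero_or_pos A with rfl | hA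
        · simp
        · rw [← mul_pow_sub_one hA.ne' t]; ring
      have : t * (h' t * t ^ A - h t * (A * t ^ (A - 1))) = t ^ A * (t * h' t - A * h t) := by
        linear_combination -h t * hp
      rw [this]
      exact mul_nonneg (by positivity) (sub_nonneg.2 (hi t ht'))
  have h2 := hmono (Set.left_mem_Icc.2 hx1) (Set.right_mem_Icc.2 hx1) hx1
  simp only [one_pow, div_one] at h2
  by_contra hc
  have : 0 < h x / x ^ A := div_pos (not_le.1 hc) (by positivity)
  linarith

lemma cast_descFactorial_succ (m s : ℕ) :
    (m.descFactorial (s + 1) : ℝ) = (m - s) * m.descFactorial s := by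
  rw [Nat.descFactorial_succ, Nat.cast_mul]
  rcases le_or_gt s m with h | h
  · rw [Nat.cast_sub h]
  · simp [Nat.descFactorial_eq_zero_iff_lt.2 h]

/-- The difference is s times the (s-1)-th factorial power of m - 1; the factor m restores the s-th
power of m, and 2N + 1 - m = (2N + 1 - s) - (m - s) splits off the next one. -/
lemma descFactorial_mul_sub (N m s : ℕ) :
    (m : ℝ) * (2 * N + 1 - m) / 2 * (m.descFactorial s - (m - 1).descFactorial s) =
      s / 2 * ((2 * N + 1 - s) * m.descFactorial s - m.descFactorial (s + 1)) := by
  rcases m with _ | k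
  · rcases s with _ | j <;> simp
  rcases s with _ | j
  · simp
  have h : ((k + 1).descFactorial (j + 1) : ℝ) = (k + 1) * k.descFactorial j := by
    rw [Nat.succ_descFactorial_succ]
    push_cast
    ring
  rw [cast_descFactorial_succ (k + 1) (j + 1), Nat.add_sub_cancel, cast_descFactorial_succ k, h]
  push_cast
  ring

/-- The factorial moment as a polynomial in the probability `q` that an edge is missing. -/
noncomputable def factorialMomentSum (n s : ℕ) (q : ℝ) : ℝ :=
  ∑ S ∈ (allEdges n).powerset,
    subsetWeight (allEdges n) S q * ((excess S).descFactorial s : ℝ)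

variable {n : ℕ}

lemma continuous_factorialMomentSum (n s : ℕ) : Continuous (factorialMomentSum n s) :=
  continuous_finsetSum _ fun S _ => (continuous_subsetWeight _ S).mul continuous_const

lemma factorialMomentSum_one (n s : ℕ) :
    factorialMomentSum n s 1 = (n - 1).descFactorial s := by
  rw [factorialMomentSum, sum_subsetWeight_one, excess_empty]

lemma factorialMomentSum_eq_zero {s : ℕ} (hs : n - 1 < s) (q : ℝ) :
    factorialMomentSum n s q = 0 := by
  refine Finset.sum_eq_zero fun S _ => ?_
  rw [Nat.descFactorial_eq_zero_iff_lt.2 ((excess_le S).trans_lt hs), Nat.cast_zero, mul_zero]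

lemma exists_hasDerivAt_factorialMomentSum (hn : 1 ≤ n) (s : ℕ) {q : ℝ} (h0 : 0 < q)
    (h1 : q ≤ 1) : ∃ D, HasDerivAt (factorialMomentSum n s) D q ∧
      (s : ℝ) / 2 * ((2 * ((n - 1 : ℕ) : ℝ) + 1 - s) * factorialMomentSum n s q -
        factorialMomentSum n (s + 1) q) ≤ q * D := by
  refine ⟨_, hasDerivAt_sum_subsetWeight (allEdges n)
    (fun S _ => ((excess S).descFactorial s : ℝ)) (fun _ => 0) h0.ne'
    (fun S _ => hasDerivAt_const _ _), ?_⟩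
  rw [← mul_assoc, mul_inv_cancel₀ h0.ne', one_mul, factorialMomentSum, factorialMomentSum,
    Finset.mul_sum, ← Finset.sum_sub_distrib, Finset.mul_sum]
  refine Finset.sum_le_sum fun S _ => ?_
  have hmono : MonotoneOn (fun m : ℕ => (m.descFactorial s : ℝ)) (Set.Iic (n - 1)) :=
    fun a _ b _ hab => Nat.cast_le.2 (Nat.descFactorial_le s hab)
  have h := mul_le_mul_of_nonneg_left (le_sum_sub_insert hn hmono S)
    (subsetWeight_nonneg (allEdges n) S h0.le h1)
  simp only [descFactorial_mul_sub] at h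
  rw [mul_zero, add_zero]
  refine Eq.trans_le ?_ (h.trans_eq ?_)
  · ring
  · congr!

/-- The supersolution property of v^(s+1) (2 - v), with v = x^N and common factors removed. The
right side minus the left is the product in `key` plus s v; s ≥ 2 gives s(2 - v) ≥ 2. -/
lemma polynomial_supersolution {N s v : ℝ} (hs : 0 ≤ s) (hsN : s ≤ N) (h : 2 ≤ s ∨ s = N)
    (hv0 : 0 ≤ v) (hv1 : v ≤ 1) :
    N * (2 * (s + 1) - (s + 2) * v) ≤
      s * (2 * N + 1 - s) * (2 - v) - s * (N - s) * (v * (2 - v)) := by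
  have key : 0 ≤ (N - s) * ((1 - v) * (s * (2 - v) - 2)) := by
    rcases h with h | h
    · refine mul_nonneg (by linarith) (mul_nonneg (by linarith) ?_)
      nlinarith
    · simp [h]
  nlinarith [mul_nonneg hs hv0]

/-- The induction starts at s > N, where both sides vanish. The subtracted power makes both sides
agree at x = 1. Setting q = x^2 avoids half-integer exponents. -/
lemma factorialMomentSum_sq_le (N d : ℕ) : ∀ s : ℕ, N < s + d → (2 ≤ s ∨ N ≤ s) →
    ∀ x : ℝ, 0 < x → x ≤ 1 → factorialMomentSum (N + 1) s (x ^ 2) ≤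
      N.descFactorial s * (2 * x ^ (N * (s + 1)) - x ^ (N * (s + 2))) := by
  induction d with
  | zero =>
    intro s hs _ x _ _
    rw [factorialMomentSum_eq_zero (by simpa using hs), Nat.descFactorial_eq_zero_iff_lt.2 (by simpa using hs)]
    simp
  | succ d ih =>
    intro s hs h x hx hx1
    rcases lt_or_ge N s with hsN | hsN
    · exact ih s (by omega) h x hx hx1
    choose! D hD hD' using fun q (h0 : 0 < q) (h1 : q ≤ 1) =>
      exists_hasDerivAt_factorialMomentSum (n := N + 1) (by omega) s h0 h1
    set C : ℝ := (N.descFactorial s : ℝ) with hC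
    have hC0 : 0 ≤ C := Nat.cast_nonneg _
    have hsq : ∀ t ∈ Set.Icc x 1, 0 < t ^ 2 ∧ t ^ 2 ≤ 1 := fun t ht =>
      ⟨pow_pos (hx.trans_le ht.1) 2, pow_le_one₀ (hx.le.trans ht.1) ht.2⟩
    -- Since t d/dt = 2 q d/dq for q = t^2, the coefficient (s/2)(2N + 1 - s) doubles to a natural
    -- number; s ≤ N keeps the subtraction exact.
    have key := nonpos_of_le_mul_deriv
      (h := fun t => factorialMomentSum (N + 1) s (t ^ 2) -
        C * (2 * t ^ (N * (s + 1)) - t ^ (N * (s + 2))))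
      (h' := fun t => D (t ^ 2) * (2 * t) - C * (2 * ((N * (s + 1) : ℕ) * t ^ (N * (s + 1) - 1)) -
        (N * (s + 2) : ℕ) * t ^ (N * (s + 2) - 1))) (s * (2 * N + 1 - s)) hx hx1 ?_ ?_ ?_
    · linarith
    · intro t ht
      have h1 := HasDerivAt.comp (h₂ := factorialMomentSum (N + 1) s) (h := fun t => t ^ 2) t
        (hD _ (hsq t ht).1 (hsq t ht).2) (hasDerivAt_pow 2 t)
      refine (h1.sub ((((hasDerivAt_pow _ t).const_mul 2).sub
        (hasDerivAt_pow _ t)).const_mul C)).congr_deriv ?_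
      simp
    · intro t ht
      have ht0 : 0 < t := hx.trans_le ht.1
      have hp : ∀ A : ℕ, t * (A * t ^ (A - 1)) = A * t ^ A := by
        intro A
        rcases Nat.eq_zero_or_pos A with rfl | hA
        · simp
        · rw [← mul_pow_sub_one hA.ne' t]; ring
      have h1 := hD' _ (hsq t ht).1 (hsq t ht).2
      have h2 := ih (s + 1) (by omega) (by omega) t ht0 ht.2
      rw [cast_descFactorial_succ, ← hC] at h2
      have h3 := polynomial_supersolution (N := N) (s := s) (v := t ^ N) (Nat.cast_nonneg _)
        (Nat.cast_le.2 hsN) (h.imp (fun h => by exact_mod_cast h)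
          (fun h => by exact_mod_cast le_antisymm hsN h)) (by positivity)
        (pow_le_one₀ ht0.le ht.2)
      have h4 := mul_le_mul_of_nonneg_left h3 (mul_nonneg hC0 (pow_nonneg ht0.le (N * (s + 1))))
      have e1 : t ^ (N * (s + 2)) = t ^ (N * (s + 1)) * t ^ N := by rw [← pow_add]; ring_nf
      have e2 : t ^ (N * (s + 1 + 1)) = t ^ (N * (s + 1)) * t ^ N := by rw [← pow_add]; ring_nf
      have e3 : t ^ (N * (s + 1 + 2)) = t ^ (N * (s + 1)) * t ^ N * t ^ N := by
        rw [← pow_add, ← pow_add]; ring_nf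
      have hA : ((s * (2 * N + 1 - s) : ℕ) : ℝ) = s * (2 * N + 1 - s) := by
        rw [Nat.cast_mul, Nat.cast_sub (by omega)]; push_cast; ring
      have h5 := mul_le_mul_of_nonneg_left h2 (Nat.cast_nonneg (α := ℝ) s)
      have e4 : t * (D (t ^ 2) * (2 * t) - C * (2 * ((N * (s + 1) : ℕ) * t ^ (N * (s + 1) - 1)) -
          (N * (s + 2) : ℕ) * t ^ (N * (s + 2) - 1))) = 2 * (t ^ 2 * D (t ^ 2)) -
          C * (2 * ((N * (s + 1) : ℕ) * t ^ (N * (s + 1))) -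
            (N * (s + 2) : ℕ) * t ^ (N * (s + 2))) := by
        rw [← hp, ← hp]; ring
      rw [e2, e3] at h5
      simp only [Nat.add_sub_cancel] at h1
      simp only [e4, hA, e1]
      push_cast
      linear_combination 2 * h1 + h5 + h4
    · rw [one_pow, factorialMomentSum_one, one_pow, one_pow, Nat.add_sub_cancel, ← hC]
      linarith

end UpperBound

/-! ### The first moment. -/

section FirstMoment

/-- A supersolution of the backward equation of the pure death chain with rates
`m (2 N + 1 - m) / 2`, where `e` is `exp (- N t)`. -/
noncomputable def decayProfile (κ : ℝ) (m : ℕ) (e : ℝ) : ℝ :=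
  m * e / (1 - (m - 1) * (κ * (1 - e)))

/-- The choice κ = 1/(2k) is made for this bound, the source of the constant 2 when s = 1. -/
lemma half_le_decayProfile_denom {k : ℝ} (hk : 0 < k) {a e : ℝ} (ha : a ≤ k) (h0 : 0 ≤ e)
    (h1 : e ≤ 1) : 1 / 2 ≤ 1 - a * (1 / (2 * k) * (1 - e)) := by
  have h2 : 0 ≤ 1 / (2 * k) := by positivity
  have h3 : a * (1 / (2 * k)) ≤ 1 / 2 := by
    rw [mul_one_div, div_le_div_iff₀ (by positivity) two_pos]
    linarith
  rcases le_or_gt 0 a with h | h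
  · nlinarith [mul_nonneg h h2]
  · nlinarith [mul_nonneg h2 (sub_nonneg.2 h1)]

lemma monotoneOn_decayProfile {k : ℕ} (hk : 0 < k) {e : ℝ} (h0 : 0 ≤ e) (h1 : e ≤ 1) :
    MonotoneOn (fun m => decayProfile (1 / (2 * k)) m e) (Set.Iic (k + 1)) := by
  intro a _ b hb hab
  have hk' : (0 : ℝ) < k := Nat.cast_pos.2 hk
  have hb' : (b : ℝ) ≤ k + 1 := by exact_mod_cast hb
  have hab' : (a : ℝ) ≤ b := Nat.cast_le.2 hab
  have hc : 0 ≤ 1 / (2 * (k : ℝ)) * (1 - e) := mul_nonneg (by positivity) (sub_nonneg.2 h1)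
  have hd := half_le_decayProfile_denom hk' (a := (b : ℝ) - 1) (by linarith) h0 h1
  exact div_le_div₀ (by positivity) (mul_le_mul_of_nonneg_right hab' h0) (by linarith)
    (by nlinarith)

lemma hasDerivAt_decayProfile (κ : ℝ) (m : ℕ) {e : ℝ} (h : 1 - ((m : ℝ) - 1) * (κ * (1 - e)) ≠ 0) :
    HasDerivAt (decayProfile κ m)
      (m * (1 - (m - 1) * κ) / (1 - (m - 1) * (κ * (1 - e))) ^ 2) e := by
  have h1 := (hasDerivAt_id e).const_mul (m : ℝ)
  have h2 := ((((hasDerivAt_id e).const_sub 1).const_mul κ).const_mul ((m : ℝ) - 1)).const_sub 1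
  refine (h1.div h2 h).congr_deriv ?_
  simp only [id]
  ring

lemma decayProfile_supersolution {k : ℕ} (hk : 0 < k) {m : ℕ} (hm : m ≤ k + 1) {e : ℝ}
    (h0 : 0 ≤ e) (h1 : e ≤ 1) :
    ((k + 1 : ℕ) : ℝ) * e * (m * (1 - (m - 1) * (1 / (2 * k))) /
        (1 - (m - 1) * (1 / (2 * k) * (1 - e))) ^ 2) ≤
      (m : ℝ) * (2 * ((k + 1 : ℕ) : ℝ) + 1 - m) / 2 *
        (decayProfile (1 / (2 * k)) m e - decayProfile (1 / (2 * k)) (m - 1) e) := by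
  rcases m with _ | a
  · simp
  have hk' : (0 : ℝ) < k := Nat.cast_pos.2 hk
  have ha : (a : ℝ) ≤ k := by exact_mod_cast Nat.le_of_succ_le_succ hm
  have hd := half_le_decayProfile_denom hk' ha h0 h1
  have hd1 := half_le_decayProfile_denom hk' (a := (a : ℝ) - 1) (by linarith) h0 h1
  rw [Nat.add_sub_cancel]
  unfold decayProfile
  push_cast
  rw [add_sub_cancel_right]
  set κ : ℝ := 1 / (2 * (k : ℝ)) with hκ
  have hκ0 : 0 < κ := by positivity
  have hκk : κ * k = 1 / 2 := by rw [hκ]; field_simp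
  clear_value κ
  set c := κ * (1 - e) with hc
  have hc0 : 0 ≤ c := mul_nonneg hκ0.le (by linarith)
  have hcκ : c ≤ κ := by nlinarith
  have ha0 : (0 : ℝ) ≤ a := Nat.cast_nonneg a
  clear_value c
  set D := 1 - (a : ℝ) * c with hD
  set D1 := 1 - ((a : ℝ) - 1) * c with hD1
  have hD0 : 0 < D := by linarith
  have hD10 : 0 < D1 := by linarith
  -- The claim after removing common factors. As κ k = 1/2, the gap is exactly a(κ D1 - (k + 1 -
  -- a/2) c^2), nonnegative because c ≤ κ and (k + 1 - a/2) c ≤ D1.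
  have key : ((k : ℝ) + 1) * (1 - a * κ) * D1 ≤ (2 * k + 2 - a) / 2 * (1 + c) * D := by
    have h2 : (k + 1 - a / 2) * c ≤ D1 := by
      have h3 : (k + a / 2) * c ≤ 1 := by
        have : (k + a / 2) * c ≤ (k + k / 2) * κ := by gcongr
        nlinarith
      rw [hD1]; nlinarith
    have h4 : 0 ≤ a * (κ * D1 - (k + 1 - a / 2) * c * c) := by
      refine mul_nonneg ha0 (sub_nonneg.2 ?_)
      have h5 : 0 ≤ (k + 1 - a / 2) * c := mul_nonneg (by linarith) hc0
      nlinarith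
    have h6 : (k : ℝ) * (a * κ) = a / 2 := by linear_combination (a : ℝ) * hκk
    have h7 : (2 * k + 2 - a) / 2 * (1 + c) * D - ((k : ℝ) + 1) * (1 - a * κ) * D1 =
        a * (κ * D1 - (k + 1 - a / 2) * c * c) := by
      rw [hD, hD1]
      linear_combination (1 - ((a : ℝ) - 1) * c) * h6
    linarith
  have e1 : ((a : ℝ) + 1) * e / D - a * e / D1 = e * (1 + c) / (D * D1) := by
    rw [div_sub_div _ _ hD0.ne' hD10.ne']
    congr 1
    rw [hD, hD1]
    ring
  rw [e1, show ((k : ℝ) + 1) * e * ((a + 1) * (1 - a * κ) / D ^ 2) =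
      e * (a + 1) * (((k : ℝ) + 1) * (1 - a * κ) * D1) / (D ^ 2 * D1) by field_simp,
    show ((a : ℝ) + 1) * (2 * (k + 1) + 1 - (a + 1)) / 2 * (e * (1 + c) / (D * D1)) =
      e * (a + 1) * ((2 * k + 2 - a) / 2 * (1 + c) * D) / (D ^ 2 * D1) by field_simp; ring]
  gcongr

/-- With e = (y/q)^N and N = k + 1, the expected profile is nondecreasing in q on [y, 1]. At q = y
the profile is m itself; at q = 1 the graph is empty and the value is N y^N over a denominator at
least 1/2. -/
lemma factorialMomentSum_one_le {k : ℕ} (hk : 0 < k) {y : ℝ} (hy : 0 < y) (hy1 : y ≤ 1) :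
    factorialMomentSum (k + 2) 1 y ≤ 2 * ((k + 1 : ℕ) : ℝ) * y ^ (k + 1) := by
  have hk' : (0 : ℝ) < k := Nat.cast_pos.2 hk
  set κ : ℝ := 1 / (2 * (k : ℝ)) with hκ
  set E := allEdges (k + 2) with hE
  set e : ℝ → ℝ := fun q => (y * q⁻¹) ^ (k + 1) with he
  have he01 : ∀ q ∈ Set.Icc y 1, 0 ≤ e q ∧ e q ≤ 1 := by
    intro q hq
    have hq0 : 0 < q := hy.trans_le hq.1
    refine ⟨by positivity, pow_le_one₀ (by positivity) ?_⟩
    rw [← div_eq_mul_inv, div_le_one hq0]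
    exact hq.1
  have hed : ∀ q, q ≠ 0 → HasDerivAt e (-((k + 1 : ℕ) * e q) * q⁻¹) q := by
    intro q hq
    refine (((hasDerivAt_inv hq).const_mul y).pow (k + 1)).congr_deriv ?_
    simp only [he, Nat.add_sub_cancel]
    rw [← inv_pow]
    ring
  have hm : ∀ S : Finset (Sym2 (Fin (k + 2))), (excess S : ℝ) - 1 ≤ k := by
    intro S
    have := excess_le S
    rw [sub_le_iff_le_add]
    exact_mod_cast this
  have hF : ∀ q ∈ Set.Icc y 1, HasDerivAt
      (fun q => ∑ S ∈ E.powerset, subsetWeight E S q * decayProfile κ (excess S) (e q))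
      (q⁻¹ * ∑ S ∈ E.powerset, subsetWeight E S q *
        (∑ x ∈ E \ S, (decayProfile κ (excess S) (e q) - decayProfile κ (excess (insert x S)) (e q))
          + q * (((excess S) * (1 - (excess S - 1) * κ) /
            (1 - (excess S - 1) * (κ * (1 - e q))) ^ 2) * (-((k + 1 : ℕ) * e q) * q⁻¹)))) q := by
    intro q hq
    have hq0 : q ≠ 0 := (hy.trans_le hq.1).ne'
    refine hasDerivAt_sum_subsetWeight E (fun S q => decayProfile κ (excess S) (e q)) _ hq0
      fun S _ => ?_
    have hd := half_le_decayProfile_denom hk' (hm S) (he01 q hq).1 (he01 q hq).2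
    exact HasDerivAt.comp (h₂ := decayProfile κ (excess S)) (h := e) q
      (hasDerivAt_decayProfile κ _ (by rw [hκ]; linarith)) (hed q hq0)
  have hmono : MonotoneOn
      (fun q => ∑ S ∈ E.powerset, subsetWeight E S q * decayProfile κ (excess S) (e q))
      (Set.Icc y 1) := by
    refine monotoneOn_of_deriv_nonneg (convex_Icc _ _)
      (fun q hq => (hF q hq).continuousAt.continuousWithinAt)
      (fun q hq => (hF q (interior_subset hq)).differentiableAt.differentiableWithinAt) ?_
    intro q hq
    replace hq := interior_subset hq
    have hq0 : 0 < q := hy.trans_le hq.1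
    rw [(hF q hq).deriv]
    refine mul_nonneg (inv_nonneg.2 hq0.le) (Finset.sum_nonneg fun S _ =>
      mul_nonneg (subsetWeight_nonneg E S hq0.le hq.2) ?_)
    have h1 := le_sum_sub_insert (by omega)
      (monotoneOn_decayProfile hk (he01 q hq).1 (he01 q hq).2) S
    have h2 := decayProfile_supersolution hk (excess_le S) (he01 q hq).1 (he01 q hq).2
    have h3 := h2.trans h1
    rw [← hκ] at h3
    rw [show q * ((excess S) * (1 - (excess S - 1) * κ) /
            (1 - (excess S - 1) * (κ * (1 - e q))) ^ 2 * (-((k + 1 : ℕ) * e q) * q⁻¹)) =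
        -(((k + 1 : ℕ) : ℝ) * e q * ((excess S) * (1 - (excess S - 1) * κ) /
            (1 - (excess S - 1) * (κ * (1 - e q))) ^ 2)) by
      field_simp]
    rw [← sub_eq_add_neg, sub_nonneg]
    refine h3.trans_eq ?_
    congr!
  have h := hmono (Set.left_mem_Icc.2 hy1) (Set.right_mem_Icc.2 hy1) hy1
  have ey : e y = 1 := by simp [he, hy.ne']
  have e1 : e 1 = y ^ (k + 1) := by simp [he]
  simp only [ey, sum_subsetWeight_one, excess_empty, e1] at h
  have hl : factorialMomentSum (k + 2) 1 y =
      ∑ S ∈ E.powerset, subsetWeight E S y * decayProfile κ (excess S) 1 := by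
    simp [factorialMomentSum, decayProfile, hE]
  rw [hl]
  refine h.trans ?_
  have hy' : y ^ (k + 1) ≤ 1 := pow_le_one₀ hy.le hy1
  have hd := half_le_decayProfile_denom hk' le_rfl (pow_nonneg hy.le (k + 1)) hy'
  rw [decayProfile, show k + 2 - 1 = k + 1 by omega,
    show ((k + 1 : ℕ) : ℝ) - 1 = k by push_cast; ring, div_le_iff₀ (by rw [hκ]; linarith)]
  have : 0 ≤ ((k + 1 : ℕ) : ℝ) * y ^ (k + 1) := by positivity
  rw [← hκ] at hd
  nlinarith

end FirstMoment

/-! ### Lower bound from isolated vertices. -/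

section LowerBound

variable {n : ℕ}

/-- The edges of the complete graph with an end in `A`. -/
def edgesAt (A : Finset (Fin n)) : Finset (Sym2 (Fin n)) :=
  (allEdges n).filter fun e => ∃ v ∈ A, v ∈ e

lemma card_edgesAt_le (A : Finset (Fin n)) : (edgesAt A).card ≤ (n - 1) * A.card := by
  have hsub : edgesAt A ⊆ A.biUnion fun v => (Finset.univ.erase v).image fun w => s(v, w) := by
    intro e he
    rw [edgesAt, Finset.mem_filter, allEdges, Finset.mem_filter] at he
    obtain ⟨⟨_, hd⟩, v, hv, hve⟩ := he
    obtain ⟨w, rfl⟩ := Sym2.mem_iff_exists.1 hve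
    rw [Finset.mem_biUnion]
    refine ⟨v, hv, Finset.mem_image.2 ⟨w, ?_, rfl⟩⟩
    rw [Sym2.mk_isDiag_iff] at hd
    simpa using Ne.symm hd
  refine (Finset.card_le_card hsub).trans (Finset.card_biUnion_le_card_mul _ _ _ fun v _ => ?_)
    |>.trans_eq (mul_comm _ _)
  refine Finset.card_image_le.trans ?_
  simp

/-- Isolated vertices other than a given one force further components. -/
lemma card_isolated_le_excess (r : Fin n) (S : Finset (Sym2 (Fin n))) :
    ((Finset.univ.erase r).filter fun v => ∀ e ∈ S, v ∉ e).card ≤ excess S := by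
  classical
  set I := (Finset.univ.erase r).filter fun v => ∀ e ∈ S, v ∉ e with hI
  set g := SimpleGraph.fromEdgeSet (S : Set (Sym2 (Fin n))) with hg
  have hr : r ∉ I := by simp [hI]
  have hiso : ∀ v ∈ I, ∀ w, g.Reachable v w → v = w := by
    intro v hv w hvw
    by_contra hne
    obtain ⟨p⟩ := hvw
    cases p with
    | nil => exact hne rfl
    | cons h _ =>
      exact (Finset.mem_filter.1 hv).2 _ ((SimpleGraph.fromEdgeSet_adj _).1 h).1
        (Sym2.mem_mk_left _ _)
  -- The component of r is counted besides the isolated ones, which offsets the 1 subtracted in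
  -- `excess`.
  have hinj : Set.InjOn g.connectedComponentMk (insert r I : Finset (Fin n)) := by
    intro v hv w hw h
    have hvw := SimpleGraph.ConnectedComponent.exact h
    rw [Finset.mem_coe, Finset.mem_insert] at hv hw
    rcases hv with rfl | hv
    · rcases hw with rfl | hw
      · rfl
      · exact (hiso w hw _ hvw.symm).symm
    · exact hiso v hv _ hvw
  have h := Finset.card_le_card_of_injOn (t := Finset.univ) g.connectedComponentMk
    (fun _ _ => Finset.mem_coe.2 (Finset.mem_univ _)) hinj
  rw [Finset.card_insert_of_notMem hr, Finset.card_univ, ← Nat.card_eq_fintype_card] at h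
  exact Nat.le_sub_of_add_le h

/-- The s-th factorial power of the isolated count is s! times the number of isolated s-sets;
isolating s vertices forbids at most (n - 1) s edges. -/
lemma le_factorialMomentSum (hn : 1 ≤ n) (s : ℕ) {q : ℝ} (h0 : 0 ≤ q) (h1 : q ≤ 1) :
    (n - 1).descFactorial s * q ^ ((n - 1) * s) ≤ factorialMomentSum n s q := by
  classical
  set r : Fin n := ⟨0, hn⟩
  set I : Finset (Sym2 (Fin n)) → Finset (Fin n) := fun S =>
    (Finset.univ.erase r).filter fun v => ∀ e ∈ S, v ∉ e with hI
  set P := (Finset.univ.erase r).powersetCard s with hP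
  have hchoose : ∀ S, ((I S).card.choose s : ℝ) = ∑ A ∈ P, if A ⊆ I S then (1 : ℝ) else 0 := by
    intro S
    rw [Finset.sum_boole, ← Finset.card_powersetCard]
    congr 2
    ext A
    simp only [hP, Finset.mem_powersetCard, Finset.mem_filter]
    exact ⟨fun h => ⟨⟨h.1.trans (Finset.filter_subset _ _), h.2⟩, h.1⟩,
      fun h => ⟨h.2, h.1.2⟩⟩
  have hA : ∀ A ∈ P, q ^ ((n - 1) * s) ≤ ∑ S ∈ (allEdges n).powerset,
      subsetWeight (allEdges n) S q * if A ⊆ I S then (1 : ℝ) else 0 := by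
    intro A hA
    rw [hP, Finset.mem_powersetCard] at hA
    calc q ^ ((n - 1) * s) ≤ q ^ (edgesAt A).card :=
          pow_le_pow_of_le_one h0 h1 (hA.2 ▸ card_edgesAt_le A)
      _ = ∑ S ∈ (allEdges n \ edgesAt A).powerset, subsetWeight (allEdges n) S q :=
          (sum_subsetWeight_sdiff _ _ (Finset.filter_subset _ _) q).symm
      _ = ∑ S ∈ (allEdges n \ edgesAt A).powerset,
          subsetWeight (allEdges n) S q * if A ⊆ I S then (1 : ℝ) else 0 := by
          refine Finset.sum_congr rfl fun S hS => ?_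
          rw [if_pos, mul_one]
          intro v hv
          refine Finset.mem_filter.2 ⟨hA.1 hv, fun e he hve => ?_⟩
          have := Finset.mem_sdiff.1 (Finset.mem_powerset.1 hS he)
          exact this.2 (Finset.mem_filter.2 ⟨this.1, v, hv, hve⟩)
      _ ≤ _ := Finset.sum_le_sum_of_subset_of_nonneg
          (Finset.powerset_mono.2 Finset.sdiff_subset) fun S _ _ =>
          mul_nonneg (subsetWeight_nonneg _ _ h0 h1) (by split_ifs <;> norm_num)
  have hcard : P.card = (n - 1).choose s := by
    rw [hP, Finset.card_powersetCard, Finset.card_erase_of_mem (Finset.mem_univ _),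
      Finset.card_fin]
  calc ((n - 1).descFactorial s : ℝ) * q ^ ((n - 1) * s)
      = s.factorial * (P.card • q ^ ((n - 1) * s)) := by
        rw [Nat.descFactorial_eq_factorial_mul_choose, hcard, nsmul_eq_mul]
        push_cast
        ring
    _ ≤ s.factorial * ∑ A ∈ P, ∑ S ∈ (allEdges n).powerset,
          subsetWeight (allEdges n) S q * if A ⊆ I S then (1 : ℝ) else 0 :=
        mul_le_mul_of_nonneg_left (Finset.card_nsmul_le_sum _ _ _ hA) (Nat.cast_nonneg _)
    _ = ∑ S ∈ (allEdges n).powerset,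
          subsetWeight (allEdges n) S q * ((I S).card.descFactorial s : ℝ) := by
        rw [Finset.sum_comm, Finset.mul_sum]
        refine Finset.sum_congr rfl fun S _ => ?_
        rw [← Finset.mul_sum, ← hchoose, Nat.descFactorial_eq_factorial_mul_choose]
        push_cast
        ring
    _ ≤ factorialMomentSum n s q :=
        Finset.sum_le_sum fun S _ => mul_le_mul_of_nonneg_left
          (Nat.cast_le.2 (Nat.descFactorial_le s (card_isolated_le_excess r S)))
          (subsetWeight_nonneg _ _ h0 h1)

end LowerBound

/-! ### Assembling the bounds. -/

lemma factorialMomentSum_sq_le_two_mul {n s : ℕ} (hn : 1 ≤ n) (hs : 1 ≤ s) {x : ℝ} (hx : 0 ≤ x)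
    (hx1 : x ≤ 1) : factorialMomentSum n s (x ^ 2) ≤
      2 * (n - 1).descFactorial s * x ^ ((n - 1) * (s + 1)) := by
  have hpos : ∀ x ∈ Set.Ioo (0 : ℝ) 1, factorialMomentSum n s (x ^ 2) ≤
      2 * (n - 1).descFactorial s * x ^ ((n - 1) * (s + 1)) := by
    rintro x ⟨hx, hx1⟩
    obtain ⟨N, rfl⟩ : ∃ N, n = N + 1 := ⟨n - 1, by omega⟩
    rw [Nat.add_sub_cancel]
    by_cases h : 2 ≤ s ∨ N ≤ s
    · refine (factorialMomentSum_sq_le N (N + 1) s (by omega) h x hx hx1.le).trans ?_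
      have h1 : (0 : ℝ) ≤ N.descFactorial s * x ^ (N * (s + 2)) := by positivity
      linarith
    · obtain rfl : s = 1 := by omega
      obtain ⟨k, rfl⟩ : ∃ k, N = k + 1 := ⟨N - 1, by omega⟩
      have h1 := factorialMomentSum_one_le (k := k) (by omega) (pow_pos hx 2)
        (pow_le_one₀ hx.le hx1.le)
      rw [Nat.descFactorial_one]
      refine h1.trans_eq ?_
      rw [← pow_mul]
      ring
  -- The differential arguments divide by q, so x = 0 is reached by continuity.
  have hcl : x ∈ closure (Set.Ioo (0 : ℝ) 1) := by
    rw [closure_Ioo zero_ne_one]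
    exact ⟨hx, hx1⟩
  refine le_on_closure hpos ?_ ?_ hcl
  · exact ((continuous_factorialMomentSum n s).comp (continuous_pow 2)).continuousOn
  · fun_prop

theorem mainTheorem5 (n s : ℕ) (hn : 1 ≤ n) (hs : 1 ≤ s) (p : unitInterval) (q : ℝ)
    (hq : q = 1 - (p : ℝ)) :
    factorialPower ((n : ℝ) - 1) s * q ^ ((n - 1) * s) ≤ excessFactorialMoment n p s ∧
      excessFactorialMoment n p s ≤
        2 * factorialPower ((n : ℝ) - 1) s * q ^ (((n : ℝ) - 1) * ((s : ℝ) + 1) / 2) := by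
  have h0 : 0 ≤ q := hq ▸ sub_nonneg.2 p.2.2
  have h1 : q ≤ 1 := hq ▸ sub_le_self _ p.2.1
  have hE : excessFactorialMoment n p s = factorialMomentSum n s q := by
    rw [excessFactorialMoment_eq_sum hn, hq, factorialMomentSum]
  have hn' : (n : ℝ) - 1 = ((n - 1 : ℕ) : ℝ) := by rw [Nat.cast_sub hn, Nat.cast_one]
  rw [hE, hn', factorialPower_natCast]
  refine ⟨le_factorialMomentSum hn s h0 h1, ?_⟩
  have h := factorialMomentSum_sq_le_two_mul hn hs (Real.sqrt_nonneg q) (Real.sqrt_le_one.2 h1)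
  rw [Real.sq_sqrt h0] at h
  refine h.trans_eq ?_
  rw [Real.sqrt_eq_rpow, ← Real.rpow_natCast, ← Real.rpow_mul h0]
  congr 2
  push_cast
  ring
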